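/- Let $A$ be a unital associative finite-dimensional semisimple $\mathbb{R}$-algebra, with its canonical topology as a finite-dimensional real vector space, and let $\sigma\colon A\to A$ be an anti-involution, i.e. an $\mathbb{R}$-linear map with $\sigma(ab)=\sigma(b)\sigma(a)$ and $\sigma(\sigma(a))=a$ for all $a,b\in A$. Put $A^\sigma=\{a\in A\mid \sigma(a)=a\}$. Assume that $(A,\sigma)$ is Hermitian, i.e. that for all $x,y\in A^\sigma$, $x^2+y^2=0$ implies $x=y=0$, and that moreover, for all $x\in A$, $\sigma(x)x=0$ implies $x=0$. Consider the right $A$-module $A^2$ of columns with the standard symplectic form $$\omega(x,y)=\sigma(x)^t\begin{pmatrix}0&1\\-1&0\end{pmatrix}y,\qquad x,y\in A^2,$$ where $\sigma$ is applied componentwise, and let $$\mathrm{Sp}_2(A,\sigma)=\{g\in \mathrm{GL}_2(A)\mid \omega(gx,gy)=\omega(x,y)\text{ for all }x,y\in A^2\}$$ be the symplectic group over $(A,\sigma)$, with the topology induced from $\mathrm{GL}_2(A)=\mathrm{Mat}_2(A)^\times$. Then $\mathrm{Sp}_2(A,\sigma)$ is connected. -/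

import Mathlib

/-- An anti-involution on a real algebra: an `ℝ`-linear, anti-multiplicative map of order two. -/
structure AntiInvolution (A : Type*) [Ring A] [Algebra ℝ A] extends A →ₗ[ℝ] A where
  map_mul_rev' : ∀ a b : A, toFun (a * b) = toFun b * toFun a
  involutive' : ∀ a : A, toFun (toFun a) = a

namespace AntiInvolution

instance (A : Type*) [Ring A] [Algebra ℝ A] : CoeFun (AntiInvolution A) (fun _ => A → A) :=
  ⟨fun σ => σ.toLinearMap⟩

/-- The space `A^σ` of `σ`-symmetric elements. -/
def symmetric {A : Type*} [Ring A] [Algebra ℝ A] (σ : AntiInvolution A) : Set A :=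
  {a | σ a = a}

/-- Two `σ`-symmetric elements whose squares sum to zero both vanish. -/
def IsHermitian {A : Type*} [Ring A] [Algebra ℝ A] (σ : AntiInvolution A) : Prop :=
  ∀ x ∈ σ.symmetric, ∀ y ∈ σ.symmetric, x ^ 2 + y ^ 2 = 0 → x = 0 ∧ y = 0

/-- The form `σ(x)x` is anisotropic on `A`. -/
def IsAnisotropic {A : Type*} [Ring A] [Algebra ℝ A] (σ : AntiInvolution A) : Prop :=
  ∀ x : A, σ x * x = 0 → x = 0

/-- The standard symplectic form `ω(x, y) = σ(x)ᵗ Ω y` on the right module `A²` of columns,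
with `Ω = !![0, 1; -1, 0]` and `σ` applied componentwise. -/
def symplecticForm {A : Type*} [Ring A] [Algebra ℝ A] (σ : AntiInvolution A)
    (x y : Fin 2 → A) : A :=
  dotProduct (fun i => σ (x i)) (Matrix.mulVec !![0, 1; -1, 0] y)

/-- The symplectic group `Sp₂(A, σ)`: the automorphisms of the right module `A²`, that is the
elements of `GL₂(A)` acting on columns from the left, which preserve the standard symplectic
form. Its topology is the one it inherits from the unit group of `Mat₂(A)`. -/
def Sp2 {A : Type*} [Ring A] [Algebra ℝ A] (σ : AntiInvolution A) :
    Subgroup (Matrix (Fin 2) (Fin 2) A)ˣ where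
  carrier := {g | ∀ x y : Fin 2 → A,
    σ.symplecticForm (Matrix.mulVec g.val x) (Matrix.mulVec g.val y) = σ.symplecticForm x y}
  one_mem' := by
    intro x y
    simp
  mul_mem' := by
    intro g h hg hh x y
    have key := hg (Matrix.mulVec h.val x) (Matrix.mulVec h.val y)
    rw [hh x y, Matrix.mulVec_mulVec, Matrix.mulVec_mulVec] at key
    exact key
  inv_mem' := by
    intro g hg x y
    have key := hg (Matrix.mulVec (g⁻¹).val x) (Matrix.mulVec (g⁻¹).val y)
    rw [Matrix.mulVec_mulVec, Matrix.mulVec_mulVec, Units.mul_inv, Matrix.one_mulVec,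
      Matrix.one_mulVec] at key
    exact key.symm

end AntiInvolution

/-! It suffices to write every element of `Sp₂(A, σ)` as a product of elements of the identity
component. The unipotents with symmetric parameter `s` are joined to `1` by scaling `s`. If the
upper left entry `a` of `g` is invertible, the symplectic relations give a factorization lower
unipotent · `diag(a, σ(a)⁻¹)` · upper unipotent (`Sp2.mem_of_mul_eq_one`).

Two points remain. First, some real `t` makes `a + t c` invertible (`exists_add_smul_mul_eq_one`).
Otherwise its determinant vanishes identically in `t`, hence also at `t = i`. But `(σ(a) - iσ(c))(a
+ ic) = σ(a)a + σ(c)c`, which is invertible because Hermitian squares are positive and the column is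
unimodular.

Second, diagonal matrices lie in the component (`Sp2.diag_mem`). Polar decomposition reduces `a` to
a symmetric unit, whose diagonal matrix is a product of unipotents, and a unitary `u`; a symmetric
sign reduces `u` to the case where `u + σ(u)` is nonnegative.

All of this rests on a finite spectral theorem for symmetric elements and on the positivity
statement `eq_zero_of_add_eq_zero`. -/

open Polynomial

namespace AntiInvolution

/-! ### Spectral theorem for symmetric elements and positivity of Hermitian squares. -/

section Algebraic

variable {A : Type*} [Ring A] [Algebra ℝ A] (σ : AntiInvolution A)

theorem map_mul_rev (a b : A) : σ (a * b) = σ b * σ a := σ.map_mul_rev' a b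

theorem apply_apply (a : A) : σ (σ a) = a := σ.involutive' a

theorem map_one' : σ (1 : A) = 1 := by
  have h := σ.map_mul_rev (σ 1) 1
  rw [mul_one, σ.apply_apply, mul_one] at h
  exact h.symm

theorem map_pow_symmetric {b : A} (hb : σ b = b) (n : ℕ) : σ (b ^ n) = b ^ n := by
  induction n with
  | zero => simpa using σ.map_one'
  | succ n ih => rw [pow_succ, σ.map_mul_rev, ih, hb, ← pow_succ, ← pow_succ']

theorem map_aeval {b : A} (hb : σ b = b) (p : ℝ[X]) : σ (aeval b p) = aeval b p := by
  induction p using Polynomial.induction_on' with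
  | add p q hp hq => rw [_root_.map_add, _root_.map_add, hp, hq]
  | monomial n a =>
    rw [aeval_monomial, ← Algebra.smul_def, _root_.map_smul, σ.map_pow_symmetric hb]

variable {σ}

/-- The functional calculus of a symmetric element lives on a finite set of real numbers. -/
theorem IsHermitian.exists_finset_aeval_eq_zero [Module.Finite ℝ A] (hH : σ.IsHermitian) {b : A}
    (hb : σ b = b) :
    ∃ S : Finset ℝ, ∀ p : ℝ[X], (∀ r ∈ S, p.eval r = 0) → aeval b p = 0 := by
  have hint : IsIntegral ℝ b := Algebra.IsIntegral.isIntegral b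
  have hne : minpoly ℝ b ≠ 0 := minpoly.ne_zero hint
  have hsq : ∀ y : A, σ y = y → y ^ 2 = 0 → y = 0 := fun y hy h =>
    (hH y hy 0 (by simp [symmetric]) (by simpa using h)).1
  -- A nonreal root gives `minpoly = ((X - re)² + im²) q`. Then `((X - re) q)² + (im q)²` kills `b`,
  -- so by Hermitianity `q(b) = 0`, against minimality of the degree.
  have hroot : ∀ z : ℂ, aeval z (minpoly ℝ b) = 0 → z.im = 0 := by
    intro z hz
    by_contra him
    obtain ⟨q, hq⟩ := quadratic_dvd_of_aeval_eq_zero_im_ne_zero _ hz him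
    have hquad : (X ^ 2 - C (2 * z.re) * X + C (‖z‖ ^ 2) : ℝ[X])
        = (X - C z.re) ^ 2 + (C z.im) ^ 2 := by
      rw [Complex.sq_norm, Complex.normSq_apply]
      simp only [C_mul, C_add, C_ofNat]
      ring
    rw [hquad] at hq
    have h0 : aeval b (((X - C z.re) * q) ^ 2 + (C z.im * q) ^ 2) = 0 := by
      have : ((X - C z.re) * q) ^ 2 + (C z.im * q) ^ 2 = minpoly ℝ b * q := by rw [hq]; ring
      rw [this, _root_.map_mul, minpoly.aeval, zero_mul]
    rw [_root_.map_add, _root_.map_pow, _root_.map_pow] at h0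
    have h1 := (hH _ (σ.map_aeval hb _) _ (σ.map_aeval hb _) h0).2
    have hq0 : q ≠ 0 := by rintro rfl; exact hne (by rw [hq, mul_zero])
    have hdvd : minpoly ℝ b ∣ C z.im * q := minpoly.dvd ℝ b h1
    rw [hq] at hdvd
    have hdeg := natDegree_le_of_dvd hdvd (mul_ne_zero (by simpa using him) hq0)
    rw [← hquad, natDegree_C_mul him, natDegree_mul _ hq0] at hdeg
    · have : (X ^ 2 - C (2 * z.re) * X + C (‖z‖ ^ 2) : ℝ[X]).natDegree = 2 := by compute_degree!
      omega
    · intro h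
      rw [hquad] at h
      exact hne (by rw [hq, h, zero_mul])
  have hsplits : (minpoly ℝ b).Splits := by
    obtain ⟨u, hu⟩ := UniqueFactorizationMonoid.factors_prod hne
    rw [← hu]
    refine (Splits.multisetProd fun g hgf => Splits.of_degree_eq_one ?_).mul u.isUnit.splits
    have hg := UniqueFactorizationMonoid.irreducible_of_factor g hgf
    have hgd := UniqueFactorizationMonoid.dvd_of_mem_factors hgf
    obtain ⟨z, hz⟩ := Complex.exists_root (f := g.map (algebraMap ℝ ℂ))
      (by rw [degree_map]; exact degree_pos_of_irreducible hg)
    have hz' : aeval z g = 0 := by rwa [IsRoot, eval_map_algebraMap] at hz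
    have him : z.im = 0 := hroot z (by
      obtain ⟨q, hq⟩ := hgd
      rw [hq, _root_.map_mul, hz', zero_mul])
    have hzr : z = algebraMap ℝ ℂ z.re := Complex.ext (by simp) (by simp [him])
    rw [hzr, aeval_algebraMap_apply] at hz'
    exact degree_eq_one_of_irreducible_of_root hg (x := z.re) (by simpa using hz')
  refine ⟨(minpoly ℝ b).roots.toFinset, fun p hp => ?_⟩
  have hprod : minpoly ℝ b ∣ ∏ r ∈ (minpoly ℝ b).roots.toFinset, (X - C r) := by
    -- A double root `r` would make `(X - r) q` square to zero at `b`, and symmetric elements of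
    -- square zero vanish.
    have hnodup : (minpoly ℝ b).roots.Nodup := by
      rw [Multiset.nodup_iff_count_le_one]
      intro r
      by_contra hcount
      rw [count_roots] at hcount
      obtain ⟨q, hq⟩ := (le_rootMultiplicity_iff hne).1 (not_le.1 hcount)
      have hq0 : q ≠ 0 := by rintro rfl; exact hne (by rw [hq, mul_zero])
      have h0 : aeval b ((X - C r) * q) = 0 := by
        refine hsq _ (σ.map_aeval hb _) ?_
        rw [← _root_.map_pow]
        have : ((X - C r) * q) ^ 2 = minpoly ℝ b * q := by
          conv_rhs => rw [hq]
          ring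
        rw [this, _root_.map_mul, minpoly.aeval, zero_mul]
      have hdvd := minpoly.dvd ℝ b h0
      have hdeg := natDegree_le_of_dvd hdvd (mul_ne_zero (X_sub_C_ne_zero r) hq0)
      rw [hq, natDegree_mul (pow_ne_zero _ (X_sub_C_ne_zero r)) hq0,
        natDegree_mul (X_sub_C_ne_zero r) hq0, natDegree_pow, natDegree_X_sub_C] at hdeg
      omega
    have := hsplits.eq_prod_roots
    rw [(minpoly.monic hint).leadingCoeff, C_1, one_mul] at this
    conv_lhs => rw [this]
    rw [Finset.prod_eq_multiset_prod, Multiset.toFinset_val, hnodup.dedup]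
  have hdvd : ∏ r ∈ (minpoly ℝ b).roots.toFinset, (X - C r) ∣ p :=
    Finset.prod_dvd_of_coprime
      (fun r _ s _ hrs => isCoprime_X_sub_C_of_isUnit_sub (sub_ne_zero.2 hrs).isUnit)
      (fun r hr => dvd_iff_isRoot.2 (hp r hr))
  obtain ⟨q, hq⟩ := hprod.trans hdvd
  rw [hq, _root_.map_mul, minpoly.aeval, zero_mul]

/-- A finite system of orthogonal symmetric idempotents, summing to one, that diagonalizes `b`. -/
structure SpectralResolution (σ : AntiInvolution A) (b : A) where
  support : Finset ℝ
  proj : ℝ → A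
  symm : ∀ r, σ (proj r) = proj r
  mul_self : ∀ r ∈ support, proj r * proj r = proj r
  mul_of_ne : ∀ r ∈ support, ∀ s ∈ support, r ≠ s → proj r * proj s = 0
  sum_eq_one : ∑ r ∈ support, proj r = 1
  mul_proj : ∀ r ∈ support, b * proj r = r • proj r
  commute : ∀ r c, Commute c b → Commute c (proj r)
  ne_zero : ∀ r ∈ support, proj r ≠ 0

/-- Polynomials in `b` depend only on their values on a finite set `S`, so the Lagrange basis
polynomials of `S`, evaluated at `b`, are the spectral projections. -/
theorem IsHermitian.nonempty_spectralResolution [Module.Finite ℝ A] (hH : σ.IsHermitian) {b : A}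
    (hb : σ b = b) : Nonempty (SpectralResolution σ b) := by
  classical
  obtain ⟨S, hS⟩ := hH.exists_finset_aeval_eq_zero hb
  have hS' : ∀ p q : ℝ[X], (∀ r ∈ S, p.eval r = q.eval r) → aeval b p = aeval b q := by
    intro p q h
    rw [← sub_eq_zero, ← _root_.map_sub]
    exact hS _ fun r hr => by rw [eval_sub, h r hr, sub_self]
  have hself : ∀ r ∈ S, (Lagrange.basis S id r).eval r = (1 : ℝ) := fun r hr =>
    Lagrange.eval_basis_self (v := id) (Function.injective_id.injOn) hr
  have hoff : ∀ r, ∀ s ∈ S, r ≠ s → (Lagrange.basis S id r).eval s = (0 : ℝ) := fun r s hs hrs =>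
    Lagrange.eval_basis_of_ne (v := id) hrs hs
  let E : ℝ → A := fun r => aeval b (Lagrange.basis S id r)
  -- `S` may contain points that are not eigenvalues; filtering discards their zero projections.
  refine ⟨⟨S.filter fun r => E r ≠ 0, E, fun r => σ.map_aeval hb _, ?_, ?_, ?_, ?_, ?_, ?_⟩⟩
  · intro r hr
    have hr := (Finset.mem_filter.1 hr).1
    simp only [E]
    rw [← _root_.map_mul]
    refine hS' _ _ fun s hs => ?_
    rw [eval_mul]
    by_cases h : r = s
    · subst h; rw [hself r hr, one_mul]
    · rw [hoff r s hs h, zero_mul]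
  · intro r hr s hs hrs
    simp only [E]
    rw [← _root_.map_mul]
    refine hS _ fun t ht => ?_
    rw [eval_mul]
    by_cases h : r = t
    · subst h; rw [hoff s r ht hrs.symm, mul_zero]
    · rw [hoff r t ht h, zero_mul]
  · rw [Finset.sum_filter_ne_zero]
    simp only [E]
    rw [← _root_.map_sum, ← _root_.map_one (aeval (R := ℝ) b)]
    refine hS' _ _ fun s hs => ?_
    rw [eval_finsetSum, Finset.sum_eq_single_of_mem s hs fun r _ h => hoff r s hs h, hself s hs,
      eval_one]
  · intro r hr
    have hr := (Finset.mem_filter.1 hr).1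
    have : aeval b (X * Lagrange.basis S id r) = aeval b (C r * Lagrange.basis S id r) := by
      refine hS' _ _ fun s hs => ?_
      rw [eval_mul, eval_mul, eval_X, eval_C]
      by_cases h : r = s
      · rw [h]
      · rw [hoff r s hs h, mul_zero, mul_zero]
    rwa [_root_.map_mul, _root_.map_mul, aeval_X, aeval_C, ← Algebra.smul_def] at this
  · intro r c hc
    simp only [E]
    induction Lagrange.basis S id r using Polynomial.induction_on' with
    | add p q hp hq => rw [_root_.map_add]; exact hp.add_right hq
    | monomial n a =>
      rw [aeval_monomial]
      exact (Algebra.commute_algebraMap_right a c).mul_right (hc.pow_right n)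
  · exact fun r hr => (Finset.mem_filter.1 hr).2

namespace SpectralResolution

variable {b : A} (R : SpectralResolution σ b)

/-- The value of the function `f` at the element resolved by `R`. -/
def map (f : ℝ → ℝ) : A := ∑ r ∈ R.support, f r • R.proj r

theorem map_symm (f : ℝ → ℝ) : σ (R.map f) = R.map f := by
  simp only [map, _root_.map_sum, _root_.map_smul, R.symm]

theorem map_mul (f g : ℝ → ℝ) : R.map f * R.map g = R.map fun r => f r * g r := by
  simp only [map, Finset.sum_mul_sum]
  refine Finset.sum_congr rfl fun r hr => ?_
  rw [Finset.sum_eq_single_of_mem r hr]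
  · rw [smul_mul_smul_comm, R.mul_self r hr]
  · intro s hs hsr
    rw [smul_mul_smul_comm, R.mul_of_ne r hr s hs hsr.symm, smul_zero]

theorem map_one : R.map (fun _ => 1) = 1 := by
  simp only [map, one_smul, R.sum_eq_one]

theorem map_id : R.map (fun r => r) = b := by
  conv_rhs => rw [← mul_one b, ← R.sum_eq_one, Finset.mul_sum]
  exact Finset.sum_congr rfl fun r hr => (R.mul_proj r hr).symm

theorem map_congr {f g : ℝ → ℝ} (h : ∀ r ∈ R.support, f r = g r) : R.map f = R.map g :=
  Finset.sum_congr rfl fun r hr => by rw [h r hr]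

theorem map_add (f g : ℝ → ℝ) : R.map f + R.map g = R.map fun r => f r + g r := by
  simp only [map, add_smul, Finset.sum_add_distrib]

theorem map_smul (c : ℝ) (f : ℝ → ℝ) : c • R.map f = R.map fun r => c * f r := by
  simp only [map, Finset.smul_sum, mul_smul]

theorem map_commute (f : ℝ → ℝ) {c : A} (hc : Commute c b) : Commute c (R.map f) :=
  Commute.sum_right _ _ _ fun r _ => (R.commute r c hc).smul_right _

end SpectralResolution

/-- The form `σ(x)x` does not take the value `-e` at a nonzero symmetric idempotent `e`. -/
theorem eq_zero_of_map_mul_self_eq_neg [Module.Finite ℝ A] (hH : σ.IsHermitian)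
    (hAn : σ.IsAnisotropic) {z e : A} (he : σ e = e) (hee : e * e = e) (hze : z * e = z)
    (h : σ z * z = -e) : e = 0 := by
  by_contra hne
  have hez : e * σ z = σ z := by
    have := congrArg (fun x => σ x) hze
    simpa only [σ.map_mul_rev, he] using this
  have hb : σ (e * z + σ z * e) = e * z + σ z * e := by
    rw [_root_.map_add, σ.map_mul_rev, σ.map_mul_rev, σ.apply_apply, he, add_comm]
  obtain ⟨R⟩ := hH.nonempty_spectralResolution hb
  have heb : Commute e (e * z + σ z * e) := by
    rw [Commute, SemiconjBy, mul_add, add_mul, ← mul_assoc, hee, mul_assoc e z e, hze, ← mul_assoc,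
      hez, mul_assoc, hee]
  obtain ⟨r, hr, hre⟩ : ∃ r ∈ R.support, R.proj r * e ≠ 0 := by
    by_contra! hcon
    apply hne
    rw [← one_mul e, ← R.sum_eq_one, Finset.sum_mul]
    exact Finset.sum_eq_zero hcon
  have hc : e * R.proj r = R.proj r * e := R.commute r e heb
  -- On the subidempotent `f` of `e`, the symmetric part of `z` acts as a scalar, so the form on the
  -- span of `f` and `z f` becomes a real quadratic form times `f`.
  obtain ⟨f, hf⟩ : ∃ f, f = R.proj r * e := ⟨_, rfl⟩
  rw [← hf] at hre
  have hfs : σ f = f := by rw [hf, σ.map_mul_rev, he, R.symm, hc]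
  have hfe : f * e = f := by rw [hf, mul_assoc, hee]
  have hef : e * f = f := by rw [hf, ← mul_assoc, hc, mul_assoc, hee]
  have hff : f * f = f := by
    nth_rewrite 1 [hf]
    rw [mul_assoc, hef, hf, ← mul_assoc, R.mul_self r hr]
  have hbf : f * (e * z + σ z * e) * f = r • f := by
    rw [mul_assoc]
    have : (e * z + σ z * e) * f = r • f := by
      rw [hf, ← mul_assoc, R.mul_proj r hr, smul_mul_assoc]
    rw [this, mul_smul_comm, hff]
  have hbf' : f * z * f + f * σ z * f = r • f := by
    rw [← hbf, mul_add, add_mul, ← mul_assoc f e z, hfe, mul_assoc f (σ z * e) f,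
      mul_assoc (σ z) e f, hef, ← mul_assoc f (σ z) f]
  have hzf : f * σ z * (z * f) = -f := by
    rw [mul_assoc, ← mul_assoc (σ z), h, neg_mul, mul_neg, hef, hff]
  -- The form takes the value `(1 + t r - t²) f` at `f + t z f`. This quadratic has discriminant `r²
  -- + 4 > 0`, so it has a real root, which yields an isotropic vector.
  have key : ∀ t : ℝ, 1 + t * r - t ^ 2 = 0 → f + t • (z * f) = 0 := by
    intro t ht
    apply hAn
    rw [_root_.map_add, _root_.map_smul, σ.map_mul_rev, hfs, add_mul, mul_add, mul_add, hff,
      smul_mul_smul_comm, hzf, mul_smul_comm, smul_mul_assoc, mul_assoc (f) (σ z) f,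
      ← mul_assoc f z f, ← mul_assoc f (σ z) f]
    have : f + t • (f * z * f) + (t • (f * σ z * f) + (t * t) • -f)
        = f + t • (f * z * f + f * σ z * f) - (t * t) • f := by
      rw [smul_add, smul_neg]; abel
    rw [this, hbf', smul_smul]
    calc f + (t * r) • f - (t * t) • f = (1 + t * r - t ^ 2) • f := by
          rw [sub_smul, add_smul, one_smul, sq]
      _ = 0 := by rw [ht, zero_smul]
  set t : ℝ := (r + Real.sqrt (r ^ 2 + 4)) / 2 with htdef
  have ht : 1 + t * r - t ^ 2 = 0 := by
    have := Real.sq_sqrt (show (0 : ℝ) ≤ r ^ 2 + 4 by positivity)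
    rw [htdef]; nlinarith
  have h1 := key t ht
  have h2 : f = -(t • (z * f)) := eq_neg_of_add_eq_zero_left h1
  have h3 : f = -((t ^ 2) • f) := by
    calc f = σ f * f := by rw [hfs, hff]
      _ = σ (-(t • (z * f))) * (-(t • (z * f))) := by rw [← h2]
      _ = -((t ^ 2) • f) := by
        rw [_root_.map_neg, _root_.map_smul, σ.map_mul_rev, hfs, neg_mul_neg, smul_mul_smul_comm,
          hzf, smul_neg, sq]
  have h4 : (1 + t ^ 2) • f = 0 := by
    rw [add_smul, one_smul]
    nth_rewrite 1 [h3]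
    rw [neg_add_cancel]
  rcases smul_eq_zero.1 h4 with h5 | h5
  · have := sq_nonneg t
    linarith
  · exact hre h5

/-- Hermitian squares are positive: a sum of two of them vanishes only trivially. -/
theorem eq_zero_of_add_eq_zero [Module.Finite ℝ A] (hH : σ.IsHermitian) (hAn : σ.IsAnisotropic)
    {x y : A} (h : σ x * x + σ y * y = 0) : x = 0 := by
  by_contra hx
  have hsym : ∀ x : A, σ (σ x * x) = σ x * x := fun x => by rw [σ.map_mul_rev, σ.apply_apply]
  obtain ⟨R⟩ := hH.nonempty_spectralResolution (hsym x)
  obtain ⟨r, hr, hr0⟩ : ∃ r ∈ R.support, r ≠ 0 := by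
    by_contra! hcon
    apply hx
    apply hAn
    rw [← R.map_id, SpectralResolution.map]
    exact Finset.sum_eq_zero fun r hr => by rw [hcon r hr, zero_smul]
  -- A negative eigenvalue of `σ(w)w`, rescaled to `-1`, is excluded by the previous lemma. Since
  -- `σ(y)y = -σ(x)x`, either `x` or `y` has one.
  have main : ∀ (w : A) (c : ℝ), c < 0 → σ w * w * R.proj r = c • R.proj r → False := by
    intro w c hc hw
    refine R.ne_zero r hr (eq_zero_of_map_mul_self_eq_neg hH hAn
      (z := (Real.sqrt (-c))⁻¹ • (w * R.proj r)) (R.symm r) (R.mul_self r hr) ?_ ?_)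
    · rw [smul_mul_assoc, mul_assoc, R.mul_self r hr]
    · rw [_root_.map_smul, σ.map_mul_rev, R.symm, smul_mul_smul_comm, mul_assoc, ← mul_assoc (σ w),
        hw, mul_smul_comm, R.mul_self r hr, smul_smul, ← mul_inv,
        Real.mul_self_sqrt (by linarith), ← neg_one_smul ℝ (R.proj r)]
      congr 1
      field_simp
      rw [div_self hc.ne]
  rcases lt_or_gt_of_ne hr0 with hneg | hpos
  · exact main x r hneg (R.mul_proj r hr)
  · refine main y (-r) (by linarith) ?_
    rw [eq_neg_of_add_eq_zero_right h, neg_mul, R.mul_proj r hr, neg_smul]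

end Algebraic

/-! ### Invertible real combinations in an isotropic column. -/

section Units

variable {A : Type*} [Ring A] [Algebra ℝ A] [Module.Finite ℝ A] {σ : AntiInvolution A}

theorem exists_mul_eq_one_of_forall_mul_eq_zero {x : A} (h : ∀ z, x * z = 0 → z = 0) :
    ∃ y, x * y = 1 :=
  (LinearMap.injective_iff_surjective (f := LinearMap.mulLeft ℝ x)).1
    ((injective_iff_map_eq_zero _).2 h) 1

theorem mul_eq_one_comm_of_finite {x y : A} : x * y = 1 ↔ y * x = 1 :=
  have : IsNoetherianRing A := isNoetherian_of_tower ℝ inferInstance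
  mul_eq_one_comm

/-- An isotropic unimodular column has a real combination of its entries that is invertible. -/
theorem exists_add_smul_mul_eq_one (hH : σ.IsHermitian) (hAn : σ.IsAnisotropic) {a c p q : A}
    (hac : σ a * c = σ c * a) (hpq : p * a + q * c = 1) :
    ∃ (t : ℝ) (y : A), (a + t • c) * y = 1 := by
  let B := Module.finBasis ℝ A
  let M := Algebra.leftMulMatrix B
  by_contra! hcon
  have hdet : ∀ t : ℝ, (M (a + t • c)).det = 0 := by
    intro t
    by_contra hd
    obtain ⟨y, hy⟩ := exists_mul_eq_one_of_forall_mul_eq_zero (x := a + t • c) fun z hz => by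
      have h1 : (M (a + t • c)).mulVec (B.repr z) = 0 := by
        rw [Algebra.leftMulMatrix_mulVec_repr, hz, _root_.map_zero, Finsupp.coe_zero]
      have h2 := Matrix.eq_zero_of_mulVec_eq_zero hd h1
      exact B.repr.map_eq_zero_iff.1 (DFunLike.coe_injective h2)
    exact hcon t y hy
  let P : ℝ[X] := ((M a).map C + (X : ℝ[X]) • (M c).map C).det
  have hP : P = 0 := by
    refine Polynomial.funext fun t => ?_
    change evalRingHom t P = eval t 0
    rw [RingHom.map_det, eval_zero, ← hdet t]
    congr 1
    ext i j
    simpa using mul_comm _ _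
  -- The zero polynomial `P` is evaluated at `i`, so that `a + ic` is singular in the complexified
  -- regular representation.
  have hQ : ((M a).map Complex.ofRealHom + Complex.I • (M c).map Complex.ofRealHom).det = 0 := by
    have : aeval Complex.I P = 0 := by rw [hP, _root_.map_zero]
    change ((aeval Complex.I : ℝ[X] →ₐ[ℝ] ℂ) : ℝ[X] →+* ℂ) P = 0 at this
    rw [← this, RingHom.map_det]
    congr 1
    ext i j
    simpa using mul_comm _ _
  obtain ⟨y, hy⟩ := exists_mul_eq_one_of_forall_mul_eq_zero (x := σ a * a + σ c * c) fun z hz => by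
    have hz' : σ (a * z) * (a * z) + σ (c * z) * (c * z) = 0 := by
      calc _ = σ z * ((σ a * a + σ c * c) * z) := by
            rw [σ.map_mul_rev, σ.map_mul_rev]; noncomm_ring
        _ = 0 := by rw [hz, mul_zero]
    have h1 := eq_zero_of_add_eq_zero hH hAn hz'
    rw [add_comm] at hz'
    have h2 := eq_zero_of_add_eq_zero hH hAn hz'
    rw [← one_mul z, ← hpq, add_mul, mul_assoc, mul_assoc, h1, h2, mul_zero, mul_zero, add_zero]
  have hprod : ((M (σ a)).map Complex.ofRealHom - Complex.I • (M (σ c)).map Complex.ofRealHom)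
      * ((M a).map Complex.ofRealHom + Complex.I • (M c).map Complex.ofRealHom)
      * (M y).map Complex.ofRealHom = 1 := by
    have h1 : M (σ a) * M c = M (σ c) * M a := by rw [← _root_.map_mul, hac, _root_.map_mul]
    have h2 : (M (σ a) * M a + M (σ c) * M c) * M y = 1 := by
      rw [← _root_.map_mul, ← _root_.map_mul, ← _root_.map_add, ← _root_.map_mul, hy,
        _root_.map_one]
    have h1' := congrArg (fun N => N.map Complex.ofRealHom) h1
    have h2' := congrArg (fun N => N.map Complex.ofRealHom) h2
    simp only [Matrix.map_mul, Matrix.map_add _ (_root_.map_add _),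
      Matrix.map_one _ (_root_.map_zero Complex.ofRealHom) (_root_.map_one _)] at h1' h2'
    rw [← h2']
    congr 1
    rw [sub_mul, mul_add, mul_add, Matrix.smul_mul, Matrix.smul_mul, Matrix.mul_smul,
      Matrix.mul_smul, smul_smul, Complex.I_mul_I, h1', neg_one_smul]
    abel
  have := congrArg Matrix.det hprod
  rw [Matrix.det_mul, Matrix.det_mul, hQ, mul_zero, zero_mul, Matrix.det_one] at this
  exact zero_ne_one this

end Units

/-! ### Entry relations and elementary symplectic matrices. -/

section Symplectic

variable {A : Type*} [Ring A] [Algebra ℝ A] {σ : AntiInvolution A}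

theorem symplecticForm_eq (x y : Fin 2 → A) :
    σ.symplecticForm x y = σ (x 0) * y 1 - σ (x 1) * y 0 := by
  simp [symplecticForm, dotProduct, Matrix.mulVec, Fin.sum_univ_two, sub_eq_add_neg]

/-- The symplectic matrix with the given entries. -/
def Sp2.ofEntries (σ : AntiInvolution A) (a b c d : A) (hac : σ a * c = σ c * a)
    (hbd : σ b * d = σ d * b) (hone : σ a * d - σ c * b = 1)
    (hright : !![a, b; c, d] * !![σ d, -σ b; -σ c, σ a] = (1 : Matrix (Fin 2) (Fin 2) A)) :
    σ.Sp2 :=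
  ⟨⟨!![a, b; c, d], !![σ d, -σ b; -σ c, σ a], hright, by
    have hone' := congrArg (fun x => σ x) hone
    simp only [_root_.map_sub, σ.map_mul_rev, σ.apply_apply, σ.map_one'] at hone'
    rw [Matrix.mul_fin_two, Matrix.one_fin_two, neg_mul, neg_mul, neg_mul, neg_mul, hac, hbd,
      ← sub_eq_add_neg, hone', add_neg_cancel, neg_add_cancel, neg_add_eq_sub, hone]⟩, by
    intro x y
    have hone' := congrArg (fun x => σ x) hone
    simp only [_root_.map_sub, σ.map_mul_rev, σ.apply_apply, σ.map_one'] at hone'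
    simp only [symplecticForm_eq, Matrix.mulVec, dotProduct, Fin.sum_univ_two, Matrix.of_apply,
      Matrix.cons_val', Matrix.cons_val_zero, Matrix.cons_val_one, Matrix.cons_val_fin_one,
      _root_.map_add, σ.map_mul_rev]
    calc _ = σ (x 0) * (σ a * c - σ c * a) * y 0 + σ (x 0) * (σ a * d - σ c * b) * y 1
          - σ (x 1) * (σ d * a - σ b * c) * y 0 + σ (x 1) * (σ b * d - σ d * b) * y 1 := by
          noncomm_ring
      _ = _ := by rw [hac, hbd, hone, hone']; simp⟩

theorem Sp2.entries_relations (g : σ.Sp2) :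
    σ (g.1.1 0 0) * g.1.1 1 0 = σ (g.1.1 1 0) * g.1.1 0 0 ∧
    σ (g.1.1 0 1) * g.1.1 1 1 = σ (g.1.1 1 1) * g.1.1 0 1 ∧
    σ (g.1.1 0 0) * g.1.1 1 1 - σ (g.1.1 1 0) * g.1.1 0 1 = 1 := by
  have h1 := g.2 ![1, 0] ![1, 0]
  have h2 := g.2 ![0, 1] ![0, 1]
  have h3 := g.2 ![1, 0] ![0, 1]
  simp only [symplecticForm_eq, Matrix.mulVec, dotProduct, Fin.sum_univ_two, Matrix.cons_val_zero,
    Matrix.cons_val_one, Matrix.cons_val_fin_one, mul_one, mul_zero, add_zero, zero_add,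
    σ.map_one', _root_.map_zero, sub_zero, sub_self] at h1 h2 h3
  exact ⟨sub_eq_zero.1 h1, sub_eq_zero.1 h2, h3⟩

/-- The upper unipotent symplectic matrix of a symmetric element. -/
def Sp2.upper {s : A} (hs : σ s = s) : σ.Sp2 :=
  Sp2.ofEntries σ 1 s 0 1 (by simp) (by simp [hs, σ.map_one']) (by simp [σ.map_one'])
    (by simp [Matrix.one_fin_two, hs, σ.map_one'])

/-- The lower unipotent symplectic matrix of a symmetric element. -/
def Sp2.lower {s : A} (hs : σ s = s) : σ.Sp2 :=
  Sp2.ofEntries σ 1 0 s 1 (by simp [hs, σ.map_one']) (by simp) (by simp [σ.map_one'])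
    (by simp [Matrix.one_fin_two, hs, σ.map_one'])

/-- The diagonal symplectic matrix with first entry `a` and second entry `d = σ(a)⁻¹`. -/
def Sp2.diag {a d : A} (had : σ a * d = 1) (hda : d * σ a = 1) : σ.Sp2 :=
  Sp2.ofEntries σ a 0 0 d (by simp) (by simp) (by simp [had]) (by
    have := congrArg (fun x => σ x) hda
    simp only [σ.map_mul_rev, σ.apply_apply, σ.map_one'] at this
    simp [Matrix.one_fin_two, hda, this])

theorem Sp2.ext {g h : σ.Sp2} (H : g.1.1 = h.1.1) : g = h := Subtype.ext (Units.ext H)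

theorem Sp2.diag_mul {a d a' d' : A} (h₁ : σ a * d = 1) (h₂ : d * σ a = 1) (h₁' : σ a' * d' = 1)
    (h₂' : d' * σ a' = 1) (h₃ : σ (a * a') * (d * d') = 1) (h₄ : (d * d') * σ (a * a') = 1) :
    Sp2.diag h₁ h₂ * Sp2.diag h₁' h₂' = Sp2.diag h₃ h₄ := by
  apply Sp2.ext
  simp [Sp2.diag, Sp2.ofEntries]

/-- Whitehead's identity: the first three factors multiply to `!![0, s; -s', 0]` and the last three
to `!![0, -1; 1, 0]`. -/
theorem Sp2.diag_eq_of_symm {s s' : A} (hs : σ s = s) (h : s * s' = 1)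
    (h' : s' * s = 1) (h₁ : σ s * s' = 1) (h₂ : s' * σ s = 1) (hn : σ (-s') = -s')
    (hone : σ (1 : A) = 1) (hneg : σ (-1 : A) = -1) :
    Sp2.diag h₁ h₂ = Sp2.upper hs * Sp2.lower hn * Sp2.upper hs *
      (Sp2.upper hneg * Sp2.lower hone * Sp2.upper hneg) := by
  apply Sp2.ext
  simp [Sp2.diag, Sp2.upper, Sp2.lower, Sp2.ofEntries, h, h']

end Symplectic

/-! ### Connecting the factors to the identity. -/

section Topological

variable {A : Type*} [Ring A] [Algebra ℝ A] [Module.Finite ℝ A] [TopologicalSpace A]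
  [IsTopologicalRing A] [ContinuousSMul ℝ A] [T2Space A] {σ : AntiInvolution A}

theorem continuous_coe (σ : AntiInvolution A) : Continuous fun a => σ a :=
  LinearMap.continuous_of_finiteDimensional σ.toLinearMap

/-- The unit topology also requires continuity of the inverse, whose entries are, up to sign, `σ` of
the given ones. -/
theorem Sp2.continuous_ofEntries {X : Type*} [TopologicalSpace X] {a b c d : X → A}
    (ha : Continuous a) (hb : Continuous b) (hc : Continuous c) (hd : Continuous d)
    (h₁ : ∀ x, σ (a x) * c x = σ (c x) * a x) (h₂ : ∀ x, σ (b x) * d x = σ (d x) * b x)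
    (h₃ : ∀ x, σ (a x) * d x - σ (c x) * b x = 1)
    (h₄ : ∀ x, !![a x, b x; c x, d x] * !![σ (d x), -σ (b x); -σ (c x), σ (a x)]
      = (1 : Matrix (Fin 2) (Fin 2) A)) :
    Continuous fun x => Sp2.ofEntries σ (a x) (b x) (c x) (d x) (h₁ x) (h₂ x) (h₃ x) (h₄ x) := by
  have hσ := σ.continuous_coe
  refine Continuous.subtype_mk (Units.continuous_iff.2 ⟨?_, ?_⟩) _
  · refine continuous_matrix fun i j => ?_
    fin_cases i <;> fin_cases j <;> simpa [Sp2.ofEntries]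
  · change Continuous fun x => !![σ (d x), -σ (b x); -σ (c x), σ (a x)]
    refine continuous_matrix fun i j => ?_
    fin_cases i <;> fin_cases j <;> simp
    exacts [hσ.comp hd, (hσ.comp hb).neg, (hσ.comp hc).neg, hσ.comp ha]

/-- The connected component of the identity of `Sp₂(A, σ)`. -/
def Sp2.identityComponent (σ : AntiInvolution A) : Subgroup σ.Sp2 :=
  Subgroup.connectedComponentOfOne σ.Sp2

theorem Sp2.mem_identityComponent_of_path {A : Type*} [Ring A] [Algebra ℝ A] [TopologicalSpace A]
    [IsTopologicalRing A] {σ : AntiInvolution A} {γ : ℝ → σ.Sp2} (hγ : Continuous γ) {s t : ℝ}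
    (h : γ s = 1) : γ t ∈ Sp2.identityComponent σ :=
  (isPreconnected_range hγ).subset_connectedComponent ⟨s, h⟩ ⟨t, rfl⟩

theorem Sp2.upper_mem {s : A} (hs : σ s = s) : Sp2.upper hs ∈ Sp2.identityComponent σ := by
  have hts : ∀ t : ℝ, σ (t • s) = t • s := fun t => by rw [_root_.map_smul, hs]
  have hc : Continuous fun t : ℝ => Sp2.upper (hts t) :=
    Sp2.continuous_ofEntries continuous_const (by fun_prop) continuous_const continuous_const
      _ _ _ _
  have h1 : Sp2.upper (hts 1) = Sp2.upper hs := Sp2.ext (by simp [Sp2.upper, Sp2.ofEntries])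
  rw [← h1]
  exact Sp2.mem_identityComponent_of_path hc (s := 0)
    (Sp2.ext (by simp [Sp2.upper, Sp2.ofEntries, Matrix.one_fin_two]))

theorem Sp2.lower_mem {s : A} (hs : σ s = s) : Sp2.lower hs ∈ Sp2.identityComponent σ := by
  have hts : ∀ t : ℝ, σ (t • s) = t • s := fun t => by rw [_root_.map_smul, hs]
  have hc : Continuous fun t : ℝ => Sp2.lower (hts t) :=
    Sp2.continuous_ofEntries continuous_const continuous_const (by fun_prop) continuous_const
      _ _ _ _
  have h1 : Sp2.lower (hts 1) = Sp2.lower hs := Sp2.ext (by simp [Sp2.lower, Sp2.ofEntries])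
  rw [← h1]
  exact Sp2.mem_identityComponent_of_path hc (s := 0)
    (Sp2.ext (by simp [Sp2.lower, Sp2.ofEntries, Matrix.one_fin_two]))

theorem Sp2.diag_mem_of_symm {s s' : A} (hs : σ s = s) (hs' : σ s' = s') (h : s * s' = 1)
    (h' : s' * s = 1) (h₁ : σ s * s' = 1) (h₂ : s' * σ s = 1) :
    Sp2.diag h₁ h₂ ∈ Sp2.identityComponent σ := by
  have hn : σ (-s') = -s' := by rw [_root_.map_neg, hs']
  have hneg : σ (-1 : A) = -1 := by rw [_root_.map_neg, σ.map_one']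
  rw [Sp2.diag_eq_of_symm hs h h' h₁ h₂ hn σ.map_one' hneg]
  exact mul_mem (mul_mem (mul_mem (Sp2.upper_mem _) (Sp2.lower_mem _)) (Sp2.upper_mem _))
    (mul_mem (mul_mem (Sp2.upper_mem _) (Sp2.lower_mem _)) (Sp2.upper_mem _))

/-- A unitary element with nonnegative symmetric part is joined to `1` by a segment of units. -/
theorem Sp2.diag_mem_of_add_map_abs {u b : A} (R : SpectralResolution σ b) (hu : σ u * u = 1)
    (habs : u + σ u = R.map fun r => |r|) (hu' : u * σ u = 1) :
    Sp2.diag hu hu' ∈ Sp2.identityComponent σ := by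
  -- The weights `cos² θ` and `sin² θ` traverse the segment from `u` to `1` with a parameter in all
  -- of `ℝ`. The function `δ θ` of `b` is `σ(v)v`, positive because `cos⁴ + sin⁴ > 0`; thus `v δ⁻¹`
  -- is `σ(v)⁻¹`.
  let δ : ℝ → ℝ → ℝ := fun θ r =>
    Real.cos θ ^ 4 + Real.sin θ ^ 4 + Real.cos θ ^ 2 * Real.sin θ ^ 2 * |r|
  have hδ : ∀ θ r, δ θ r ≠ 0 := by
    intro θ r
    have h1 := Real.cos_sq_add_sin_sq θ
    have h2 : 0 ≤ Real.cos θ ^ 2 * Real.sin θ ^ 2 * |r| := by positivity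
    have h3 : 0 < Real.cos θ ^ 4 + Real.sin θ ^ 4 := by
      nlinarith [sq_nonneg (Real.cos θ ^ 2 - Real.sin θ ^ 2)]
    exact (add_pos_of_pos_of_nonneg h3 h2).ne'
  let v : ℝ → A := fun θ => Real.cos θ ^ 2 • u + Real.sin θ ^ 2 • 1
  have hvv : ∀ θ, σ (v θ) * v θ = R.map (δ θ) := by
    intro θ
    have h1 : σ (v θ) * v θ = (Real.cos θ ^ 4 + Real.sin θ ^ 4) • (1 : A) +
        (Real.cos θ ^ 2 * Real.sin θ ^ 2) • (u + σ u) := by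
      simp only [v, _root_.map_add, _root_.map_smul, σ.map_one', add_mul, mul_add,
        smul_mul_smul_comm, hu, mul_one, one_mul]
      module
    rw [h1, habs, ← R.map_one, R.map_smul, R.map_smul, R.map_add]
    exact R.map_congr fun r _ => by simp only [δ]; ring
  let w : ℝ → A := fun θ => v θ * R.map fun r => (δ θ r)⁻¹
  have hvw : ∀ θ, σ (v θ) * w θ = 1 := by
    intro θ
    rw [← mul_assoc, hvv, R.map_mul, ← R.map_one]
    exact R.map_congr fun r _ => mul_inv_cancel₀ (hδ θ r)
  have hwv : ∀ θ, w θ * σ (v θ) = 1 := fun θ => mul_eq_one_comm_of_finite.1 (hvw θ)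
  have hvc : Continuous v := by fun_prop
  have hwc : Continuous w := by
    refine hvc.mul (continuous_finsetSum _ fun r _ => ?_)
    refine (Continuous.inv₀ ?_ fun θ => hδ θ r).smul continuous_const
    fun_prop
  have hc : Continuous fun θ : ℝ => Sp2.diag (hvw θ) (hwv θ) :=
    Sp2.continuous_ofEntries hvc continuous_const continuous_const hwc _ _ _ _
  have hv0 : v 0 = u := by simp [v]
  have hw0 : w 0 = u := by
    have h := hvw 0
    rw [hv0] at h
    rw [← one_mul (w 0), ← hu', mul_assoc, h, mul_one]
  have hv1 : v (Real.pi / 2) = 1 := by simp [v]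
  have hw1 : w (Real.pi / 2) = 1 := by
    have h := hvw (Real.pi / 2)
    rwa [hv1, σ.map_one', one_mul] at h
  have h0 : Sp2.diag (hvw 0) (hwv 0) = Sp2.diag hu hu' :=
    Sp2.ext (by simp [Sp2.diag, Sp2.ofEntries, hv0, hw0])
  rw [← h0]
  exact Sp2.mem_identityComponent_of_path hc (s := Real.pi / 2)
    (Sp2.ext (by simp [Sp2.diag, Sp2.ofEntries, Matrix.one_fin_two, hv1, hw1]))

/-- The segment from `u` to `1` can meet singular elements, for instance when `u = -1`. Multiplying
by the sign `ε` of `u + σ(u)`, which commutes with `u`, replaces this sum by its absolute value. -/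
theorem Sp2.diag_mem_of_unitary (hH : σ.IsHermitian) {u : A} (hu : σ u * u = 1)
    (hu' : u * σ u = 1) : Sp2.diag hu hu' ∈ Sp2.identityComponent σ := by
  obtain ⟨R⟩ := hH.nonempty_spectralResolution (b := u + σ u)
    (by rw [_root_.map_add, σ.apply_apply, add_comm])
  -- The value `1` at `0` makes `ε² = 1` hold also on the kernel of `u + σ(u)`.
  let sgn : ℝ → ℝ := fun r => if r < 0 then -1 else 1
  let ε := R.map sgn
  have hεs : σ ε = ε := R.map_symm _
  have hε : ε * ε = 1 := by
    rw [R.map_mul, ← R.map_one]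
    exact R.map_congr fun r _ => by simp only [sgn]; split_ifs <;> norm_num
  have hc1 : u * ε = ε * u := R.map_commute sgn (by
    rw [Commute, SemiconjBy, mul_add, add_mul, hu, hu'])
  have hc2 : σ u * ε = ε * σ u := R.map_commute sgn (by
    rw [Commute, SemiconjBy, mul_add, add_mul, hu, hu'])
  have h1 : σ (u * ε) * (u * ε) = 1 := by
    rw [σ.map_mul_rev, hεs, mul_assoc, ← mul_assoc (σ u), hu, one_mul, hε]
  have h2 : u * ε * σ (u * ε) = 1 := mul_eq_one_comm_of_finite.1 h1
  have habs : u * ε + σ (u * ε) = R.map fun r => |r| := by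
    rw [σ.map_mul_rev, hεs, ← hc2, ← add_mul]
    conv_lhs => rw [← R.map_id]
    rw [R.map_mul]
    refine R.map_congr fun r _ => ?_
    simp only [sgn]
    split_ifs with h
    · rw [abs_of_neg h]; ring
    · rw [abs_of_nonneg (not_lt.1 h), mul_one]
  have hε1 : σ ε * ε = 1 := by rw [hεs, hε]
  have hε2 : ε * σ ε = 1 := by rw [hεs, hε]
  have hu3 : u * ε * ε = u := by rw [mul_assoc, hε, mul_one]
  have heq : Sp2.diag h1 h2 * Sp2.diag hε1 hε2 = Sp2.diag hu hu' := by
    rw [Sp2.diag_mul h1 h2 hε1 hε2 (by rw [hu3, hu]) (by rw [hu3, hu'])]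
    exact Sp2.ext (by simp [Sp2.diag, Sp2.ofEntries, hu3])
  rw [← heq]
  exact mul_mem (Sp2.diag_mem_of_add_map_abs R h1 habs h2)
    (Sp2.diag_mem_of_symm hεs hεs hε hε hε1 hε2)

/-- Polar decomposition `a = (a p⁻¹) p` with `p = √(σ(a)a)`, where `a p⁻¹` is unitary and `p` is
symmetric. -/
theorem Sp2.diag_mem (hH : σ.IsHermitian) (hAn : σ.IsAnisotropic) {a d : A} (had : σ a * d = 1)
    (hda : d * σ a = 1) : Sp2.diag had hda ∈ Sp2.identityComponent σ := by
  have hsd : σ d * a = 1 := by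
    have := congrArg (fun x => σ x) had
    simpa only [σ.map_mul_rev, σ.apply_apply, σ.map_one'] using this
  obtain ⟨R⟩ := hH.nonempty_spectralResolution (b := σ a * a)
    (by rw [σ.map_mul_rev, σ.apply_apply])
  have hpos : ∀ r ∈ R.support, 0 < r := by
    intro r hr
    by_contra hr0
    -- For an eigenvalue `r ≤ 0`, adding a Hermitian square equal to `-r • R.proj r` gives zero;
    -- positivity then forces `a * R.proj r = 0`, which is impossible for invertible `a`.
    have h : σ (a * R.proj r) * (a * R.proj r) +
        σ (√(-r) • R.proj r) * (√(-r) • R.proj r) = 0 := by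
      rw [_root_.map_smul, smul_mul_smul_comm, Real.mul_self_sqrt (by linarith), σ.map_mul_rev,
        R.symm, mul_assoc, ← mul_assoc (σ a), R.mul_proj r hr, mul_smul_comm, R.mul_self r hr,
        neg_smul, add_neg_cancel]
    have h0 := eq_zero_of_add_eq_zero hH hAn h
    apply R.ne_zero r hr
    rw [← one_mul (R.proj r), ← hsd, mul_assoc, h0, mul_zero]
  let p := R.map fun r => √r
  let q := R.map fun r => (√r)⁻¹
  have hps : σ p = p := R.map_symm _
  have hqs : σ q = q := R.map_symm _
  have hpq : p * q = 1 := by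
    rw [R.map_mul, ← R.map_one]
    exact R.map_congr fun r hr => mul_inv_cancel₀ (Real.sqrt_pos.2 (hpos r hr)).ne'
  have hqp : q * p = 1 := mul_eq_one_comm_of_finite.1 hpq
  have hpp : σ a * a = p * p := by
    conv_lhs => rw [← R.map_id]
    rw [R.map_mul]
    exact R.map_congr fun r hr => (Real.mul_self_sqrt (hpos r hr).le).symm
  have hu : σ (a * q) * (a * q) = 1 := by
    rw [σ.map_mul_rev, hqs, mul_assoc, ← mul_assoc (σ a), hpp, mul_assoc p p q, hpq, mul_one, hqp]
  have hu' : a * q * σ (a * q) = 1 := mul_eq_one_comm_of_finite.1 hu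
  have hp1 : σ p * q = 1 := by rw [hps, hpq]
  have hp2 : q * σ p = 1 := by rw [hps, hqp]
  have ha : a * q * p = a := by rw [mul_assoc, hqp, mul_one]
  have hd : a * q * q = d := by
    calc a * q * q = d * σ a * (a * q * q) := by rw [hda, one_mul]
      _ = d * (σ a * a) * q * q := by noncomm_ring
      _ = d := by rw [hpp, mul_assoc, mul_assoc, mul_assoc, ← mul_assoc p q q, hpq, one_mul, hpq,
        mul_one]
  have heq : Sp2.diag hu hu' * Sp2.diag hp1 hp2 = Sp2.diag had hda := by
    rw [Sp2.diag_mul hu hu' hp1 hp2 (by rw [ha, hd, had]) (by rw [ha, hd, hda])]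
    exact Sp2.ext (by simp [Sp2.diag, Sp2.ofEntries, ha, hd])
  rw [← heq]
  exact mul_mem (Sp2.diag_mem_of_unitary hH hu hu') (Sp2.diag_mem_of_symm hps hqs hpq hqp hp1 hp2)

/-- Block Gauss decomposition: the symplectic relations make `c a⁻¹` and `a⁻¹ b` symmetric and the
Schur complement `d - c a⁻¹ b` equal to `σ(a)⁻¹`. -/
theorem Sp2.mem_of_mul_eq_one (hH : σ.IsHermitian) (hAn : σ.IsAnisotropic) (g : σ.Sp2) {y : A}
    (hy : g.1.1 0 0 * y = 1) : g ∈ Sp2.identityComponent σ := by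
  have hy' : y * g.1.1 0 0 = 1 := mul_eq_one_comm_of_finite.1 hy
  obtain ⟨hac, hbd, hone⟩ := Sp2.entries_relations g
  have hg : g.1.1 = !![g.1.1 0 0, g.1.1 0 1; g.1.1 1 0, g.1.1 1 1] := Matrix.eta_fin_two _
  generalize g.1.1 0 0 = a at *
  generalize g.1.1 0 1 = b at *
  generalize g.1.1 1 0 = c at *
  generalize g.1.1 1 1 = d at *
  have hσ1 : σ a * σ y = 1 := by rw [← σ.map_mul_rev, hy', σ.map_one']
  have hσ2 : σ y * σ a = 1 := by rw [← σ.map_mul_rev, hy, σ.map_one']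
  have hcy : σ (c * y) = c * y := by
    calc σ (c * y) = σ y * (σ c * a) * y := by
          rw [σ.map_mul_rev, mul_assoc, mul_assoc, hy, mul_one]
      _ = σ y * σ a * c * y := by rw [← hac]; noncomm_ring
      _ = c * y := by rw [hσ2, one_mul]
  have hd : d = c * y * b + σ y := by
    calc d = σ y * σ a * d := by rw [hσ2, one_mul]
      _ = σ y * (σ a * d - σ c * b) + σ y * σ c * b := by noncomm_ring
      _ = c * y * b + σ y := by rw [hone, mul_one, ← σ.map_mul_rev, hcy, add_comm]
  have hyb : σ (y * b) = y * b := by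
    have h : σ b * (c * y * b + σ y) = σ (c * y * b + σ y) * b := by rw [← hd, hbd]
    rw [_root_.map_add, σ.map_mul_rev (c * y) b, hcy, σ.apply_apply, mul_add, add_mul,
      mul_assoc (σ b), add_right_inj] at h
    rw [σ.map_mul_rev, h]
  have heq : g = Sp2.lower hcy * Sp2.diag hσ1 hσ2 * Sp2.upper hyb := by
    apply Sp2.ext
    rw [hg]
    simp [Sp2.diag, Sp2.upper, Sp2.lower, Sp2.ofEntries, ← mul_assoc, hy, hd, mul_assoc c y a, hy']
  rw [heq]
  exact mul_mem (mul_mem (Sp2.lower_mem _) (Sp2.diag_mem hH hAn _ _)) (Sp2.upper_mem _)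

theorem Sp2.identityComponent_eq_top (hH : σ.IsHermitian) (hAn : σ.IsAnisotropic) :
    Sp2.identityComponent σ = ⊤ := by
  refine (Subgroup.eq_top_iff' _).2 fun g => ?_
  obtain ⟨hac, hbd, hone⟩ := Sp2.entries_relations g
  have hone' := congrArg (fun x => σ x) hone
  simp only [_root_.map_sub, σ.map_mul_rev, σ.apply_apply, σ.map_one'] at hone'
  rw [sub_eq_add_neg, ← neg_mul] at hone'
  obtain ⟨t, y, hy⟩ := exists_add_smul_mul_eq_one hH hAn hac hone'
  have ht : σ (t • (1 : A)) = t • 1 := by rw [_root_.map_smul, σ.map_one']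
  -- Left multiplication by this unipotent turns the upper left entry `a` into `a + t c`.
  have hmem := Sp2.mem_of_mul_eq_one hH hAn (Sp2.upper ht * g) (y := y) (by
    refine Eq.trans (congrArg (· * y) ?_) hy
    simp [Sp2.upper, Sp2.ofEntries, Matrix.mul_apply, Fin.sum_univ_two])
  exact (Subgroup.mul_mem_cancel_left _ (Sp2.upper_mem ht)).1 hmem

end Topological

end AntiInvolution

/-- `A` carries its unique Hausdorff vector space topology. -/
theorem mainTheorem5 {A : Type*} [Ring A] [Algebra ℝ A] [Module.Finite ℝ A] [IsSemisimpleRing A]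
    [TopologicalSpace A] [IsTopologicalAddGroup A] [ContinuousSMul ℝ A] [T2Space A]
    (σ : AntiInvolution A) (hHerm : σ.IsHermitian) (hAniso : σ.IsAnisotropic) :
    ConnectedSpace σ.Sp2 := by
  -- Continuity of multiplication is not assumed; it follows from bilinearity in finite dimension.
  have : IsModuleTopology ℝ A := isModuleTopologyOfFiniteDimensional
  have : IsTopologicalRing A := IsModuleTopology.isTopologicalRing ℝ A
  refine connectedSpace_iff_connectedComponent.2 ⟨1, ?_⟩
  have h := AntiInvolution.Sp2.identityComponent_eq_top hHerm hAniso
  exact congrArg (fun H : Subgroup σ.Sp2 => (H : Set σ.Sp2)) h
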